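/- Let $n>1$ be an integer, let $p$ be a complex polynomial of degree $n$, let $c\in\mathbb{C}$, and consider the anti-rational map $$\overline{r}(z):=\overline{c}+\frac{1}{\overline{p(z)}}$$ of the Riemann sphere $\widehat{\mathbb{C}}=\mathbb{C}\cup\{\infty\}$ to itself (so $\overline{r}(\infty)=\overline{c}$, and $\overline{r}(z)=\infty$ at the zeros $z$ of $p$). A fixed point of $\overline{r}$ is called attracting if its multiplier has modulus less than $1$ (at a finite fixed point $z$ this means $|r'(z)|<1$, where $r=c+1/p$; superattracting fixed points are included). Suppose that $\overline{r}$ has (at least) $n$ distinct attracting fixed points. Then the forward orbit $\{\overline{r}^{\,k}(\infty): k\ge 0\}$ of $\infty$ is infinite. In particular $\overline{r}$ is not post-critically finite, that is, it is not true that every critical value of $\overline{r}$ has a finite forward orbit (critical points and values are taken on $\widehat{\mathbb{C}}$). -/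

import Mathlib

open Polynomial
open scoped ComplexConjugate OnePoint

noncomputable section

namespace AntiRational

/-- The Riemann sphere `ℂ ∪ {∞}`. -/
abbrev Sphere : Type := OnePoint ℂ

/-- The coordinate on the sphere used near `a`: the coordinate `z` if `a` is finite, and `1 / z`
if `a = ∞`. In the first case the value at `∞`, and in the second case the value at `0`, is
irrelevant: these points lie outside of the domain of the chart. -/
def coord : Sphere → Sphere → ℂ
  | ∞, ∞ => 0
  | ∞, (z : ℂ) => z⁻¹
  | (_ : ℂ), ∞ => 0
  | (_ : ℂ), (z : ℂ) => z

/-- The inverse of the chart `coord a`, defined on all of `ℂ`. -/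
def coordInv : Sphere → ℂ → Sphere
  | ∞, w => if w = 0 then ∞ else ((w⁻¹ : ℂ) : Sphere)
  | (_ : ℂ), w => (w : Sphere)

/-- The map `f` of the sphere, written in the charts around `a` and around `f a`. -/
def localRep (f : Sphere → Sphere) (a : Sphere) (w : ℂ) : ℂ :=
  coord (f a) (f (coordInv a w))

/-- `m` is the complex derivative at `a`, in the charts around `a` and `f a`, of the complex
conjugate of the (anti-holomorphic) map `f`. So, if `F` is the local representative of `f`, then
`F w = F w₀ + conj (m * (w - w₀)) + o(w - w₀)`. -/
def HasConjDerivAt (f : Sphere → Sphere) (a : Sphere) (m : ℂ) : Prop :=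
  HasDerivAt (fun w : ℂ => conj (localRep f a w)) m (coord a a)

/-- Critical points of an anti-holomorphic map of the sphere. -/
def IsCriticalPt (f : Sphere → Sphere) (a : Sphere) : Prop :=
  HasConjDerivAt f a 0

/-- Attracting fixed points of an anti-holomorphic map of the sphere: the multiplier has modulus
less than one (zero is allowed, that is, the superattracting case is included). -/
def IsAttractingFixedPt (f : Sphere → Sphere) (a : Sphere) : Prop :=
  f a = a ∧ ∃ m : ℂ, HasConjDerivAt f a m ∧ ‖m‖ < 1

/-- The forward orbit `a, f a, f (f a), …`. -/
def forwardOrbit (f : Sphere → Sphere) (a : Sphere) : Set Sphere :=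
  Set.range fun k : ℕ => f^[k] a

/-- Every critical value has a finite forward orbit. -/
def IsPostCriticallyFinite (f : Sphere → Sphere) : Prop :=
  ∀ a, IsCriticalPt f a → (forwardOrbit f (f a)).Finite

/-- The map `z ↦ conj c + 1 / conj (p z)` of the sphere, for a non-constant polynomial `p`
(so that `p ∞ = ∞`): zeros of `p` go to `∞`, and `∞` goes to `conj c`. -/
def antiRat (c : ℂ) (p : ℂ[X]) : Sphere → Sphere
  | ∞ => ((conj c : ℂ) : Sphere)
  | (z : ℂ) =>
      if p.eval z = 0 then ∞ else ((conj c + 1 / conj (p.eval z) : ℂ) : Sphere)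

end AntiRational

end

/-! The derivative of `p` has at most `n - 1` roots and limits are unique, so some attracting fixed
point `z₀` attracts no finite critical point. Suppose the orbit of `∞` is finite. Then the branches
of the inverse iterates fixing `z₀` all extend to one disk (`exists_inverse_branch`): finite
critical values cause no obstruction, and a branch can meet `conj c`, the value at `∞`, only if the
orbit of `conj c` lands exactly on `z₀`, which `exists_ball_iterate_eq_imp_eq` excludes. The
derivatives of these branches at the centre grow like the inverse powers of the multiplier. But the
branches omit a fixed disk around a second attracting fixed point `z₁`, so Cauchy's estimate for `1
/ (h - z₁)` bounds these derivatives, a contradiction. -/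

open Filter Topology Metric in
/-- A continuous lift of a holomorphic function through a polynomial, over the set of regular
values, is holomorphic. -/
theorem Polynomial.hasDerivAt_of_eval_comp_eq {p : ℂ[X]} {h q : ℂ → ℂ} {w q' : ℂ}
    (hh : ContinuousAt h w) (hpq : ∀ᶠ x in 𝓝 w, p.eval (h x) = q x) (hq : HasDerivAt q q' w)
    (hp : p.derivative.eval (h w) ≠ 0) :
    HasDerivAt h (q' / p.derivative.eval (h w)) w := by
  have hs := p.hasStrictDerivAt (h w)
  have h1 := hs.to_localInverse hp
  have h2 := (hh.eventually (hs.eventually_left_inverse hp))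
  have e : p.eval (h w) = q w := hpq.self_of_nhds
  rw [e] at h1
  have h3 := h1.hasDerivAt.comp w hq
  rw [inv_mul_eq_div] at h3
  refine h3.congr_of_eventuallyEq ?_
  filter_upwards [h2, hpq] with x hx hx'
  rw [Function.comp_apply, ← hx', hx]

open Metric in
/-- A holomorphic function on a disk with values in the set of regular values of a polynomial `p`
lifts through `p`. -/
theorem Polynomial.exists_differentiableOn_lift {p : ℂ[X]} {q : ℂ → ℂ} {x₀ e₀ : ℂ} {ρ : ℝ}
    (hρ : 0 < ρ) (hq : DifferentiableOn ℂ q (ball x₀ ρ)) (he : p.eval e₀ = q x₀)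
    (hreg : ∀ w ∈ ball x₀ ρ, ∀ a, p.derivative.eval a = 0 → p.eval a ≠ q w) :
    ∃ h : ℂ → ℂ, DifferentiableOn ℂ h (ball x₀ ρ) ∧ h x₀ = e₀ ∧
      ∀ w ∈ ball x₀ ρ, p.eval (h w) = q w := by
  have hx₀ : x₀ ∈ ball x₀ ρ := mem_ball_self hρ
  have : ContractibleSpace (ball x₀ ρ) := (convex_ball x₀ ρ).contractibleSpace ⟨x₀, hx₀⟩
  have : LocallyPathConnectedSpace (ball x₀ ρ) := isOpen_ball.locallyPathConnectedSpace
  -- Over its regular values `p` is a covering, and a disk is simply connected.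
  obtain ⟨F, ⟨hF0, hF⟩, -⟩ := p.isCoveringMapOn_eval.existsUnique_continuousMap_lifts
    (⟨(ball x₀ ρ).domRestrict q, hq.continuousOn.domRestrict⟩ : C(ball x₀ ρ, ℂ))
    (a₀ := ⟨x₀, hx₀⟩) (e₀ := e₀) he
    (fun w ⟨a, ha, hw⟩ ↦ hreg w w.2 a ha hw)
  have hF' (w : ball x₀ ρ) : p.eval (F w) = q w := congrFun hF w
  classical
  set h : ℂ → ℂ := fun w ↦ if hw : w ∈ ball x₀ ρ then F ⟨w, hw⟩ else 0 with hh
  have hhF (w : ℂ) (hw : w ∈ ball x₀ ρ) : h w = F ⟨w, hw⟩ := dif_pos hw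
  have hpq (w : ℂ) (hw : w ∈ ball x₀ ρ) : p.eval (h w) = q w := by rw [hhF w hw, hF']
  have hc : ContinuousOn h (ball x₀ ρ) := by
    rw [continuousOn_iff_continuous_domRestrict]
    convert F.continuous using 1
    ext w
    exact hhF w w.2
  refine ⟨h, fun w hw ↦ ?_, by rw [hhF _ hx₀, hF0], hpq⟩
  have hn := isOpen_ball.mem_nhds hw
  refine (hasDerivAt_of_eval_comp_eq (hc.continuousAt hn) ?_
    (hq.differentiableAt hn).hasDerivAt fun h0 ↦
      hreg w hw _ h0 (hpq w hw)).differentiableAt.differentiableWithinAt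
  filter_upwards [hn] with x hx using hpq x hx

/-! ### The map in local coordinates -/

namespace AntiRational

open Filter Topology Metric

variable {c : ℂ} {p : ℂ[X]}

theorem antiRat_coe {z : ℂ} (hz : p.eval z ≠ 0) :
    antiRat c p (z : Sphere) = ((conj (c + (p.eval z)⁻¹) : ℂ) : Sphere) := by
  simp [antiRat, hz]

theorem antiRat_coe_eq_coe_iff {z w : ℂ} :
    antiRat c p (z : Sphere) = (w : Sphere) ↔ p.eval z ≠ 0 ∧ c + (p.eval z)⁻¹ = conj w := by
  by_cases hz : p.eval z = 0
  · simp [antiRat, hz]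
  · rw [antiRat_coe hz, OnePoint.coe_eq_coe]
    refine ⟨fun h ↦ ⟨hz, by rw [← h, Complex.conj_conj]⟩, fun h ↦ by rw [h.2, Complex.conj_conj]⟩

theorem hasDerivAt_const_add_inv_eval {z : ℂ} (hz : p.eval z ≠ 0) :
    HasDerivAt (fun w ↦ c + (p.eval w)⁻¹) (-p.derivative.eval z / p.eval z ^ 2) z :=
  ((p.hasDerivAt z).fun_inv hz).const_add c

/-- The attracting fixed points are finite, and the multiplier is given by the derivative of
`c + 1 / p`. -/
theorem IsAttractingFixedPt.exists_coe {a : Sphere} (ha : IsAttractingFixedPt (antiRat c p) a) :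
    ∃ z : ℂ, a = z ∧ p.eval z ≠ 0 ∧ c + (p.eval z)⁻¹ = conj z ∧
      ‖-p.derivative.eval z / p.eval z ^ 2‖ < 1 := by
  obtain ⟨hfix, m, hm, hm1⟩ := ha
  induction a using OnePoint.rec with
  | infty => exact absurd hfix (OnePoint.coe_ne_infty _)
  | coe z =>
    obtain ⟨hz, hz'⟩ := antiRat_coe_eq_coe_iff.1 hfix
    refine ⟨z, rfl, hz, hz', ?_⟩
    have h1 : HasDerivAt (fun w : ℂ => conj (localRep (antiRat c p) z w)) m z := hm
    have hev : (fun w : ℂ => conj (localRep (antiRat c p) z w)) =ᶠ[𝓝 z]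
        fun w ↦ c + (p.eval w)⁻¹ := by
      filter_upwards [p.continuous.continuousAt.eventually_ne hz] with w hw
      have : localRep (antiRat c p) z w = conj (c + (p.eval w)⁻¹) := by
        change coord (antiRat c p z) (antiRat c p (w : Sphere)) = _
        rw [hfix, antiRat_coe hw]
        rfl
      rw [this, Complex.conj_conj]
    rw [← (h1.congr_of_eventuallyEq hev.symm).unique (hasDerivAt_const_add_inv_eval hz)]
    exact hm1

/-- `∞` is a critical point if the degree of `p` is at least two. -/
theorem isCriticalPt_infty (hp : 1 < p.natDegree) : IsCriticalPt (antiRat c p) ∞ := by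
  have hp0 : p ≠ 0 := by rintro rfl; simp at hp
  change HasDerivAt (fun w : ℂ => conj (localRep (antiRat c p) ∞ w)) 0 0
  have hrev : p.reverse.eval 0 ≠ 0 := by
    rw [← coeff_zero_eq_eval_zero, coeff_zero_reverse]
    exact leadingCoeff_ne_zero.2 hp0
  -- With `w = 1 / z`, `1 / p z` is `w ^ n` over the reversed polynomial, `n` being the degree of
  -- `p`.
  have hev : (fun w : ℂ => conj (localRep (antiRat c p) ∞ w)) =ᶠ[𝓝 0]
      fun w ↦ c + w ^ p.natDegree * (p.reverse.eval w)⁻¹ := by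
    filter_upwards [p.reverse.continuous.continuousAt.eventually_ne hrev] with w hw
    change conj (coord ((conj c : ℂ) : Sphere)
      (antiRat c p (if w = 0 then ∞ else ((w⁻¹ : ℂ) : Sphere)))) = _
    split_ifs with h0
    · subst h0
      change conj (conj c) = _
      simp [show p.natDegree ≠ 0 by omega]
    · have h2 : p.eval w⁻¹ * w ^ p.natDegree = p.reverse.eval w := by
        let := invertibleOfNonzero (inv_ne_zero h0)
        have h := eval₂_reverse_mul_pow (RingHom.id ℂ) w⁻¹ p
        rw [invOf_eq_inv, inv_inv, inv_pow] at h
        rw [eval, eval, ← h, inv_mul_cancel_right₀ (pow_ne_zero _ h0)]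
      have h3 : p.eval w⁻¹ ≠ 0 := fun h ↦ hw (by rw [← h2, h, zero_mul])
      rw [antiRat_coe h3]
      change conj (conj _) = _
      rw [Complex.conj_conj, ← h2, mul_inv, mul_left_comm, mul_inv_cancel₀ (pow_ne_zero _ h0),
        mul_one]
  refine HasDerivAt.congr_of_eventuallyEq ?_ hev
  have := (((hasDerivAt_pow p.natDegree (0 : ℂ)).fun_mul
    ((p.reverse.hasDerivAt 0).fun_inv hrev))).const_add c
  convert this using 1
  rw [zero_pow (show p.natDegree ≠ 0 by omega), zero_pow (show p.natDegree - 1 ≠ 0 by omega)]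
  simp

/-! ### Local dynamics at attracting fixed points -/

/-- Near an attracting fixed point all orbits stay near that point and converge to it. -/
theorem exists_ball_attracted {z₀ : ℂ} (hz : p.eval z₀ ≠ 0) (hfix : c + (p.eval z₀)⁻¹ = conj z₀)
    (hm : ‖-p.derivative.eval z₀ / p.eval z₀ ^ 2‖ < 1) :
    ∃ δ > 0, ∀ ρ, 0 < ρ → ρ ≤ δ → ∀ z ∈ ball z₀ ρ,
      (∀ k, ∃ w ∈ ball z₀ ρ, (antiRat c p)^[k] (z : Sphere) = (w : Sphere)) ∧
      Tendsto (fun k ↦ (antiRat c p)^[k] (z : Sphere)) atTop (𝓝 (z₀ : Sphere)) := by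
  obtain ⟨κ, hmκ, hκ1⟩ := exists_between hm
  have hκ0 : 0 ≤ κ := (norm_nonneg _).trans hmκ.le
  have h1 := (hasDerivAt_const_add_inv_eval (c := c) hz).isLittleO.bound (sub_pos.2 hmκ)
  obtain ⟨δ, hδ, hball⟩ := Metric.eventually_nhds_iff_ball.1
    (h1.and (p.continuous.continuousAt.eventually_ne hz))
  have step : ∀ z ∈ ball z₀ δ, ∃ w : ℂ, antiRat c p (z : Sphere) = w ∧
      dist w z₀ ≤ κ * dist z z₀ := by
    intro z hzb
    obtain ⟨hb, hne⟩ := hball z hzb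
    refine ⟨_, antiRat_coe hne, ?_⟩
    rw [← Complex.dist_conj_conj, Complex.conj_conj, ← hfix, dist_eq_norm, dist_eq_norm]
    have h2 := norm_sub_norm_le (c + (eval z p)⁻¹ - (c + (eval z₀ p)⁻¹))
      ((z - z₀) • (-p.derivative.eval z₀ / p.eval z₀ ^ 2))
    rw [norm_smul] at h2
    nlinarith
  refine ⟨δ, hδ, fun ρ hρ hρδ z hzb ↦ ?_⟩
  have key : ∀ k, ∃ w : ℂ, (antiRat c p)^[k] (z : Sphere) = (w : Sphere) ∧
      dist w z₀ ≤ κ ^ k * dist z z₀ := by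
    intro k
    induction k with
    | zero => exact ⟨z, rfl, by simp⟩
    | succ k ih =>
      obtain ⟨w, hw, hwd⟩ := ih
      have h3 : dist w z₀ ≤ dist z z₀ :=
        hwd.trans (mul_le_of_le_one_left dist_nonneg (pow_le_one₀ hκ0 hκ1.le))
      obtain ⟨w', hw', hwd'⟩ := step w (h3.trans_lt (lt_of_lt_of_le hzb hρδ))
      refine ⟨w', by rw [Function.iterate_succ_apply', hw, hw'], hwd'.trans ?_⟩
      rw [pow_succ', mul_assoc]
      exact mul_le_mul_of_nonneg_left hwd hκ0
  choose u hu hud using key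
  refine ⟨fun k ↦ ⟨u k, lt_of_le_of_lt (hud k) (lt_of_le_of_lt (mul_le_of_le_one_left dist_nonneg
    (pow_le_one₀ hκ0 hκ1.le)) hzb), hu k⟩, ?_⟩
  simp_rw [hu]
  refine (OnePoint.continuous_coe.tendsto z₀).comp (tendsto_iff_dist_tendsto_zero.2 ?_)
  refine squeeze_zero (fun _ ↦ dist_nonneg) hud ?_
  simpa using (tendsto_pow_atTop_nhds_zero_of_lt_one hκ0 hκ1).mul_const (dist z z₀)

/-- An attracting fixed point that is not a critical point has a disk around it
that is mapped into itself and attracted, and that contains no other iterated preimage of it. -/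
theorem exists_ball_iterate_eq_imp_eq {z₀ : ℂ} (hz : p.eval z₀ ≠ 0)
    (hfix : c + (p.eval z₀)⁻¹ = conj z₀) (hcrit : p.derivative.eval z₀ ≠ 0)
    (hm : ‖-p.derivative.eval z₀ / p.eval z₀ ^ 2‖ < 1) :
    ∃ ρ > 0, ∀ z ∈ ball z₀ ρ,
      (∀ k, ∃ w ∈ ball z₀ ρ, (antiRat c p)^[k] (z : Sphere) = (w : Sphere)) ∧
      Tendsto (fun k ↦ (antiRat c p)^[k] (z : Sphere)) atTop (𝓝 (z₀ : Sphere)) ∧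
      ∀ k, (antiRat c p)^[k] (z : Sphere) = (z₀ : Sphere) → z = z₀ := by
  obtain ⟨δ, hδ, hball⟩ := exists_ball_attracted hz hfix hm
  -- A nonzero multiplier makes `z₀` its own only preimage nearby.
  have hne := (hasDerivAt_const_add_inv_eval (c := c) hz).eventually_ne (c := conj z₀)
    (div_ne_zero (neg_ne_zero.2 hcrit) (pow_ne_zero 2 hz))
  obtain ⟨ε, hε, hinj⟩ := Metric.eventually_nhds_iff_ball.1 (eventually_nhdsWithin_iff.1 hne)
  have hρ : 0 < min δ ε := lt_min hδ hε
  have hb := hball _ hρ (min_le_left _ _)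
  refine ⟨min δ ε, hρ, fun z hzb ↦ ⟨(hb z hzb).1, (hb z hzb).2, fun k ↦ ?_⟩⟩
  induction k with
  | zero => exact fun h ↦ OnePoint.coe_injective h
  | succ k ih =>
    intro h
    obtain ⟨w, hw, hkw⟩ := (hb z hzb).1 k
    rw [Function.iterate_succ_apply', hkw, antiRat_coe_eq_coe_iff] at h
    have : w = z₀ := by
      by_contra hwz
      exact hinj w (ball_subset_ball (min_le_right _ _) hw) hwz h.2
    exact ih (by rw [hkw, this])

/-! ### Inverse branches of the iterates -/

/-- If an orbit is finite and converges to a point then it reaches that point. -/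
theorem exists_iterate_eq_of_finite {f : Sphere → Sphere} {a b : Sphere}
    (hfin : (forwardOrbit f a).Finite) (h : Tendsto (fun k ↦ f^[k] a) atTop (𝓝 b)) :
    ∃ N, ∀ k ≥ N, f^[k] a = b := by
  have hn : (forwardOrbit f a \ {b})ᶜ ∈ 𝓝 b :=
    (hfin.subset Set.sdiff_subset).isClosed.isOpen_compl.mem_nhds fun h ↦ h.2 rfl
  obtain ⟨N, hN⟩ := eventually_atTop.1 (h.eventually hn)
  exact ⟨N, fun k hk ↦ by_contra fun hne ↦ hN k hk ⟨⟨k, rfl⟩, hne⟩⟩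

/-- If no critical point other than `∞` is attracted by the fixed point `z₀` and the orbit of `∞`
is finite, then the inverse branches of all iterates that fix `z₀` are defined on a common
disk. In order to have holomorphic branches only, we compose with complex conjugations. -/
theorem exists_inverse_branch {z₀ : ℂ} {ρ : ℝ} (hρ : 0 < ρ) (hz : p.eval z₀ ≠ 0)
    (hfix : c + (p.eval z₀)⁻¹ = conj z₀)
    (hball : ∀ z ∈ ball z₀ ρ,
      Tendsto (fun k ↦ (antiRat c p)^[k] (z : Sphere)) atTop (𝓝 (z₀ : Sphere)) ∧
      ∀ k, (antiRat c p)^[k] (z : Sphere) = (z₀ : Sphere) → z = z₀)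
    (hcrit : ∀ a : ℂ, p.derivative.eval a = 0 →
      ¬ Tendsto (fun k ↦ (antiRat c p)^[k] (a : Sphere)) atTop (𝓝 (z₀ : Sphere)))
    (hfin : (forwardOrbit (antiRat c p) ((conj c : ℂ) : Sphere)).Finite) (k : ℕ) :
    ∃ h : ℂ → ℂ, DifferentiableOn ℂ h (ball 0 ρ) ∧ h 0 = z₀ ∧
      (∃ d, HasDerivAt h d 0 ∧ ‖d‖ * ‖-p.derivative.eval z₀ / p.eval z₀ ^ 2‖ ^ k = 1) ∧
      ∀ w ∈ ball 0 ρ, ∃ z ∈ ball z₀ ρ, (antiRat c p)^[k] (h w : Sphere) = (z : Sphere) ∧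
        (z = z₀ → w = 0) := by
  have h0 : (0 : ℂ) ∈ ball 0 ρ := mem_ball_self hρ
  have hconj {w : ℂ} (hw : w ∈ ball 0 ρ) : conj w ∈ ball 0 ρ := by simpa using hw
  have hz₀c : conj z₀ - c = (p.eval z₀)⁻¹ := by rw [← hfix]; ring
  induction k with
  | zero =>
    refine ⟨fun w ↦ z₀ + w, by fun_prop, by simp, ⟨1, (hasDerivAt_id _).const_add _, by simp⟩,
      fun w hw ↦ ⟨z₀ + w, by simpa using hw, rfl, by simp⟩⟩
  | succ k ih =>
    obtain ⟨h, hd, hh0, ⟨d, hhd, hdk⟩, himg⟩ := ih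
    have hconv {w : ℂ} (hw : w ∈ ball 0 ρ) :
        Tendsto (fun k ↦ (antiRat c p)^[k] (h w : Sphere)) atTop (𝓝 (z₀ : Sphere)) := by
      obtain ⟨z, hzb, hkz, -⟩ := himg w hw
      rw [← tendsto_add_atTop_iff_nat k]
      simp_rw [Function.iterate_add_apply, hkz]
      exact (hball z hzb).1
    -- If the branch took the value `conj c`, the finite orbit of `conj c` would reach `z₀`; this
    -- forces `w = 0` and `conj c = z₀`, whereas `z₀` differs from `conj c` by the conjugate of `1 /
    -- p z₀`.
    have hc {w : ℂ} (hw : w ∈ ball 0 ρ) : conj (h (conj w)) - c ≠ 0 := by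
      intro heq
      have hcw : h (conj w) = conj c := by rw [← sub_eq_zero.1 heq, Complex.conj_conj]
      obtain ⟨N, hN⟩ := exists_iterate_eq_of_finite hfin (hcw ▸ hconv (hconj hw))
      obtain ⟨z, hzb, hkz, hz0⟩ := himg _ (hconj hw)
      have hzN := hN (N + k) (by omega)
      rw [Function.iterate_add_apply, ← hcw, hkz] at hzN
      have h1 := hz0 ((hball z hzb).2 N hzN)
      rw [h1, hh0] at hcw
      refine inv_ne_zero hz ?_
      rw [← hz₀c, hcw, Complex.conj_conj, sub_self]
    have hgd {w : ℂ} (hw : w ∈ ball 0 ρ) :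
        DifferentiableAt ℂ (fun w ↦ conj (h (conj w))) w := by
      have := (hd.differentiableAt (isOpen_ball.mem_nhds (hconj hw))).conj_conj
      rwa [Complex.conj_conj] at this
    have hqd : DifferentiableOn ℂ (fun w ↦ (conj (h (conj w)) - c)⁻¹) (ball 0 ρ) := fun w hw ↦
      (((hgd hw).sub_const c).fun_inv (hc hw)).differentiableWithinAt
    have hq0 : p.eval z₀ = (conj (h (conj 0)) - c)⁻¹ := by
      rw [map_zero, hh0, hz₀c, inv_inv]
    have hnext {a w : ℂ} (hw : w ∈ ball 0 ρ) (ha : p.eval a = (conj (h (conj w)) - c)⁻¹) :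
        antiRat c p (a : Sphere) = (h (conj w) : Sphere) := by
      rw [antiRat_coe_eq_coe_iff, ha, inv_inv]
      exact ⟨inv_ne_zero (hc hw), by ring⟩
    -- A critical point over a value of the branch would be attracted by `z₀`.
    obtain ⟨g, hgd', hg0, hpg⟩ := exists_differentiableOn_lift hρ hqd hq0 fun w hw a ha hpa ↦ by
      refine hcrit a ha ((tendsto_add_atTop_iff_nat 1).1 ?_)
      simp_rw [Function.iterate_succ_apply, hnext hw hpa]
      exact hconv (hconj hw)
    have hp' : p.derivative.eval z₀ ≠ 0 := fun h1 ↦ hcrit z₀ h1 <| by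
      exact (hball z₀ (mem_ball_self hρ)).1
    refine ⟨g, hgd', hg0, ?_, fun w hw ↦ ?_⟩
    · have hgderiv : HasDerivAt (fun w ↦ conj (h (conj w))) (conj d) 0 := by
        have := hhd.conj_conj
        rwa [map_zero] at this
      have h1 := (hgderiv.sub_const c).fun_inv (hc h0)
      have h2 := hasDerivAt_of_eval_comp_eq
        (hgd'.differentiableAt (isOpen_ball.mem_nhds h0)).continuousAt
        (by filter_upwards [isOpen_ball.mem_nhds h0] with w hw using hpg w hw) h1
        (by rwa [hg0])
      refine ⟨_, h2, ?_⟩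
      rw [map_zero, hh0, hz₀c, hg0, ← hdk, pow_succ' _ k, ← mul_assoc, ← norm_mul]
      congr 1
      rw [← RCLike.norm_conj d]
      congr 1
      field_simp
    · obtain ⟨z, hzb, hkz, hz0⟩ := himg _ (hconj hw)
      refine ⟨z, hzb, ?_, fun h1 ↦ by simpa using hz0 h1⟩
      rw [Function.iterate_succ_apply, hnext hw (hpg w hw), hkz]

/-! ### Derivative growth against Cauchy's estimate -/

/-- If there are two attracting fixed points, and one of them attracts no critical point other
than `∞`, then the orbit of `∞` is infinite. -/
theorem infinite_forwardOrbit_of_forall_not_tendsto {z₀ z₁ : ℂ} (hne : z₀ ≠ z₁)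
    (hz : p.eval z₀ ≠ 0) (hfix : c + (p.eval z₀)⁻¹ = conj z₀)
    (hm : ‖-p.derivative.eval z₀ / p.eval z₀ ^ 2‖ < 1)
    (hz₁ : p.eval z₁ ≠ 0) (hfix₁ : c + (p.eval z₁)⁻¹ = conj z₁)
    (hm₁ : ‖-p.derivative.eval z₁ / p.eval z₁ ^ 2‖ < 1)
    (hcrit : ∀ a : ℂ, p.derivative.eval a = 0 →
      ¬ Tendsto (fun k ↦ (antiRat c p)^[k] (a : Sphere)) atTop (𝓝 (z₀ : Sphere))) :
    (forwardOrbit (antiRat c p) ((conj c : ℂ) : Sphere)).Infinite := by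
  intro hfin
  have hp' : p.derivative.eval z₀ ≠ 0 := by
    intro h0
    refine hcrit z₀ h0 ?_
    obtain ⟨δ, hδ, hball⟩ := exists_ball_attracted hz hfix hm
    exact (hball δ hδ le_rfl z₀ (mem_ball_self hδ)).2
  obtain ⟨ρ, hρ, hball⟩ := exists_ball_iterate_eq_imp_eq hz hfix hp' hm
  obtain ⟨δ, hδ, hball₁⟩ := exists_ball_attracted hz₁ hfix₁ hm₁
  set m := ‖-p.derivative.eval z₀ / p.eval z₀ ^ 2‖ with hmdef
  have hbound (k : ℕ) : 1 ≤ m ^ k * (2 * δ⁻¹ / ρ * ‖z₀ - z₁‖ ^ 2) := by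
    obtain ⟨h, hd, hh0, ⟨d, hhd, hdk⟩, himg⟩ := exists_inverse_branch hρ hz hfix
      (fun z hz ↦ (hball z hz).2) hcrit hfin k
    -- Orbits of points of the branch tend to `z₀`, those starting near `z₁` tend to `z₁`.
    have hfar {w : ℂ} (hw : w ∈ ball 0 ρ) : δ ≤ ‖h w - z₁‖ := by
      by_contra! hlt
      obtain ⟨z, hzb, hkz, -⟩ := himg w hw
      have h1 := (hball₁ δ hδ le_rfl (h w) (mem_ball_iff_norm.2 hlt)).2
      rw [← tendsto_add_atTop_iff_nat k] at h1
      simp_rw [Function.iterate_add_apply, hkz] at h1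
      exact hne (OnePoint.coe_injective (tendsto_nhds_unique (hball z hzb).2.1 h1))
    have hne' {w : ℂ} (hw : w ∈ ball 0 ρ) : h w - z₁ ≠ 0 :=
      norm_pos_iff.1 (hδ.trans_le (hfar hw))
    have h0 : (0 : ℂ) ∈ ball 0 ρ := mem_ball_self hρ
    have hle {w : ℂ} (hw : w ∈ ball 0 ρ) : ‖(h w - z₁)⁻¹‖ ≤ δ⁻¹ := by
      rw [norm_inv]
      exact inv_anti₀ hδ (hfar hw)
    -- The radius `2 * δ⁻¹` bounds the difference of two values of norm at most `δ⁻¹`.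
    have hder := Complex.norm_deriv_le_div_of_mapsTo_ball (f := fun w ↦ (h w - z₁)⁻¹) (c := 0)
      (R₂ := 2 * δ⁻¹) ((hd.sub_const z₁).fun_inv fun w hw ↦ hne' hw) (fun w hw ↦ by
        rw [mem_closedBall_iff_norm]
        linarith [norm_sub_le (h w - z₁)⁻¹ (h 0 - z₁)⁻¹, hle hw, hle h0]) hρ
    rw [((hhd.sub_const z₁).fun_inv (hne' h0)).deriv, norm_div, norm_neg, norm_pow, hh0,
      div_le_iff₀ (pow_pos (norm_pos_iff.2 (sub_ne_zero.2 hne)) 2)] at hder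
    rw [← hdk, mul_comm]
    exact mul_le_mul_of_nonneg_left hder (pow_nonneg (norm_nonneg _) k)
  have hlim := (tendsto_pow_atTop_nhds_zero_of_lt_one (norm_nonneg _) hm).mul_const
    (2 * δ⁻¹ / ρ * ‖z₀ - z₁‖ ^ 2)
  have := ge_of_tendsto' hlim hbound
  rw [zero_mul] at this
  exact absurd this (by norm_num)

end AntiRational

theorem mainTheorem4 (n : ℕ) (hn : 1 < n) (p : Polynomial ℂ) (hp : p.natDegree = n) (c : ℂ)
    (hattr : (n : ℕ∞) ≤
      {z : OnePoint ℂ |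
        AntiRational.IsAttractingFixedPt (AntiRational.antiRat c p) z}.encard) :
    (AntiRational.forwardOrbit (AntiRational.antiRat c p) (OnePoint.infty : OnePoint ℂ)).Infinite ∧
      ¬ AntiRational.IsPostCriticallyFinite (AntiRational.antiRat c p) := by
  open AntiRational Filter Topology in
  have key : (forwardOrbit (antiRat c p) ((conj c : ℂ) : Sphere)).Infinite := by
    set A := {z : OnePoint ℂ | IsAttractingFixedPt (antiRat c p) z} with hA
    have hp' : p.derivative ≠ 0 := by
      intro h
      have := derivative_eq_zero.1 h
      omega
    obtain ⟨a, haA, ha⟩ : ∃ a ∈ A, ∀ b : ℂ, p.derivative.eval b = 0 →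
        ¬ Tendsto (fun k ↦ (antiRat c p)^[k] (b : Sphere)) atTop (𝓝 a) := by
      -- Otherwise choosing an attracted critical point for each fixed point is injective, giving
      -- `n` roots of the derivative.
      by_contra! hcon
      choose! g hg hgt using hcon
      have h1 : A.encard ≤ (p.derivative.roots.toFinset : Set ℂ).encard := by
        refine Set.encard_le_encard_of_injOn (f := g) (fun a ha ↦ ?_) fun a ha b hb hab ↦ ?_
        · simp [hp', hg a ha]
        · exact tendsto_nhds_unique (hgt a ha) (hab ▸ hgt b hb)
      rw [Set.encard_coe_eq_coe_finsetCard] at h1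
      have h2 : n ≤ p.derivative.roots.toFinset.card := by exact_mod_cast hattr.trans h1
      have h3 := p.derivative.roots.toFinset_card_le
      have h4 := p.derivative.card_roots'
      have h5 := p.natDegree_derivative_le
      omega
    obtain ⟨b, hbA, hba⟩ : ∃ b ∈ A, b ≠ a :=
      Set.exists_ne_of_one_lt_encard (lt_of_lt_of_le (by exact_mod_cast hn) hattr) a
    obtain ⟨z₀, rfl, hz, hfix, hm⟩ := IsAttractingFixedPt.exists_coe haA
    obtain ⟨z₁, rfl, hz₁, hfix₁, hm₁⟩ := IsAttractingFixedPt.exists_coe hbA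
    exact infinite_forwardOrbit_of_forall_not_tendsto
      (fun h ↦ hba (by rw [h])) hz hfix hm hz₁ hfix₁ hm₁ ha
  refine ⟨key.mono ?_, fun h ↦ key (h _ (AntiRational.isCriticalPt_infty (hp ▸ hn)))⟩
  rintro _ ⟨k, rfl⟩
  exact ⟨k + 1, rfl⟩
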